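/- Let $X$ be a reflexive real Banach space and $Z$ a real Hausdorff topological vector space. Let $C\subseteq Z$ be a convex cone ($tc\in C$ for $c\in C$, $t\ge 0$, and $C+C=C$) that is pointed, i.e. $C\cap(-C)=\{0\}$, and has nonempty interior $\operatorname{int}C$. Let $K\subseteq X$ be nonempty, convex and closed, and let $F:K\times K\times K\to Z$ satisfy the following. (i) For every $y\in K$, at least one of the following conditions holds, where convergence of nets in $K$ and neighborhoods in $X$ refer to the weak topology of $X$: (a) for every net $(x_\alpha)\subseteq K$ with $\lim x_\alpha=x\in K$: if $F(x_\alpha,y,x_\alpha)\notin-\operatorname{int}C$ for all $\alpha$, then $F(x,y,x)\notin-\operatorname{int}C$; (b) the map $x\mapsto F(x,y,x)$ is $C$-upper semicontinuous on $K$, i.e. for every $x\in K$ and every neighborhood $V$ of $F(x,y,x)$ in $Z$ there is a neighborhood $U$ of $x$ such that $F(u,y,u)\in V-C$ for all $u\in U\cap K$; (c) for every $x\in K$ and every net $(x_\alpha)\subseteq K$ with $\lim x_\alpha=x$ there is a net $(z_\alpha)\subseteq Z$, over the same index set, converging to some $z\in Z$, such that $F(x_\alpha,y,x_\alpha)-z_\alpha\in-C$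 for all $\alpha$ and $F(x,y,x)-z\in C$. (ii) For every $x\in K$ the map $y\mapsto F(x,y,x)$ is $C$-convex on $K$, i.e. $tF(x,y_1,x)+(1-t)F(x,y_2,x)-F(x,ty_1+(1-t)y_2,x)\in C$ for all $y_1,y_2\in K$ and $t\in[0,1]$. (iii) For every $x\in K$, $F(x,x,x)\in(-C)\setminus(-\operatorname{int}C)$. (iv) There is $r>0$ such that for every $x\in K$ with $\|x\|>r$ there is $y_0\in K$ with $\|y_0\|<\|x\|$ and $F(x,y_0,x)\in-C$. Then there exists $x_0\in K$ such that $F(x_0,y,x_0)\notin-\operatorname{int}C$ for all $y\in K$. -/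

import Mathlib

open Set Filter Topology
open scoped Pointwise

universe u v

/-- A real normed space is reflexive if the canonical embedding into its bidual is onto. -/
def IsReflexiveSpace (X : Type u) [NormedAddCommGroup X] [NormedSpace ℝ X] : Prop :=
  Function.Surjective (NormedSpace.inclusionInDoubleDual ℝ X)

section Cone

variable {E : Type u} {Z : Type v} [AddCommGroup Z] [Module ℝ Z] [TopologicalSpace Z]

/-- `f` is `C`-convex on `K`: `t f(x) + (1 - t) f(y) - f(t x + (1 - t) y) ∈ C` for all
`x, y ∈ K` and `t ∈ [0, 1]`. -/
def CConvexOn [AddCommGroup E] [Module ℝ E] (C : ConvexCone ℝ Z) (K : Set E) (f : E → Z) : Prop :=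
  ∀ x ∈ K, ∀ y ∈ K, ∀ t ∈ Icc (0 : ℝ) 1,
    t • f x + (1 - t) • f y - f (t • x + (1 - t) • y) ∈ C

/-- `f` is `C`-upper semicontinuous at every point of `K`, as a map on `K`: for every neighborhood
`V` of `f x` there is a neighborhood `U` of `x` with `f u ∈ V - C` for all `u ∈ U ∩ K`. -/
def CUpperSemicontinuousOn [TopologicalSpace E] (C : ConvexCone ℝ Z) (K : Set E) (f : E → Z) :
    Prop :=
  ∀ x ∈ K, ∀ V ∈ 𝓝 (f x), ∃ U ∈ 𝓝 x, ∀ u ∈ U ∩ K, f u ∈ V - (C : Set Z)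

/-- For every net in `K` converging to a point `x` of `K`: if no value of `f` along the net lies in
`-int C`, then `f x ∉ -int C`. -/
def NetClosedOn [TopologicalSpace E] (C : ConvexCone ℝ Z) (K : Set E) (f : E → Z) : Prop :=
  ∀ (ι : Type u) [Preorder ι] [IsDirected ι (· ≤ ·)] [Nonempty ι] (a : ι → E) (x : E),
    (∀ i, a i ∈ K) → x ∈ K → Tendsto a atTop (𝓝 x) →
    (∀ i, f (a i) ∉ -interior (C : Set Z)) → f x ∉ -interior (C : Set Z)

/-- For every net `a` in `K` converging to a point `x` of `K` there is a convergent net `b` in `Z`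
over the same index set, with limit `z`, such that `f (a i) - b i ∈ -C` for all `i` and
`f x - z ∈ C`. -/
def NetMajorizedOn [TopologicalSpace E] (C : ConvexCone ℝ Z) (K : Set E) (f : E → Z) : Prop :=
  ∀ (ι : Type u) [Preorder ι] [IsDirected ι (· ≤ ·)] [Nonempty ι] (a : ι → E) (x : E),
    (∀ i, a i ∈ K) → x ∈ K → Tendsto a atTop (𝓝 x) →
    ∃ (b : ι → Z) (z : Z), Tendsto b atTop (𝓝 z) ∧
      (∀ i, f (a i) - b i ∈ -(C : Set Z)) ∧ f x - z ∈ C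

/-- One of the three conditions (net-closedness, `C`-upper semicontinuity, net-majorization)
holds. -/
def ClosednessCondition [TopologicalSpace E] (C : ConvexCone ℝ Z) (K : Set E) (f : E → Z) : Prop :=
  NetClosedOn C K f ∨ CUpperSemicontinuousOn C K f ∨ NetMajorizedOn C K f

/-- `x₀` solves the weak vector equilibrium problem for the trifunction `F` on `K`. Only the values
of `F` on `K × K × K` matter. -/
def IsWeakVectorEquilibrium (C : ConvexCone ℝ Z) (K : Set E) (F : E → E → E → Z) (x₀ : E) : Prop :=
  x₀ ∈ K ∧ ∀ y ∈ K, F x₀ y x₀ ∉ -interior (C : Set Z)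

end Cone

/-- The closedness condition for a map on a subset of a normed space `X`, with respect to the weak
topology of `X`. -/
def WeakClosednessCondition {X : Type u} {Z : Type v} [NormedAddCommGroup X] [NormedSpace ℝ X]
    [AddCommGroup Z] [Module ℝ Z] [TopologicalSpace Z]
    (C : ConvexCone ℝ Z) (K : Set X) (f : X → Z) : Prop :=
  ClosednessCondition (E := WeakSpace ℝ X) C ((toWeakSpace ℝ X).symm ⁻¹' K)
    (fun x => f ((toWeakSpace ℝ X).symm x))

/-! Cut `K` down to `B`, its intersection with a closed ball. For `y ∈ B` let `G y` be the set of `x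
∈ B` with `F x y x ∉ -int C`. Each `G y` is weakly closed (`ClosednessCondition.isClosed`) and `B`
is weakly compact by reflexivity, so it suffices that finitely many `G y` meet. This is the KKM
lemma: by `C`-convexity the `y` with `F x y x ∈ -int C` form a convex set, so if `x` is a convex
combination of points `y` with `x ∉ G y`, then `F x x x ∈ -int C`, against the diagonal condition.
Coercivity then carries the solution from `B` to `K`.

KKM is deduced from Brouwer's theorem for Lipschitz maps, and that from a no-retraction theorem. If
`w` is Lipschitz and vanishes outside a ball, `id + t w` permutes the ball for small `t > 0`, so the
integral of `det (I + t Dw)` is the volume of the ball. It is polynomial in `t`, hence has the same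
value at `t = 1`, whereas a retraction onto the sphere has singular derivative. -/

/-! ### Brouwer's theorem for Lipschitz maps -/

open MeasureTheory Polynomial in
/-- Evaluation at `1` of polynomials of degree at most `n` is a fixed linear combination of
evaluations at nodes in `(0, ε)`. -/
theorem exists_nodes_eval_one (n : ℕ) {ε : ℝ} (hε : 0 < ε) :
    ∃ t c : Fin (n + 1) → ℝ, (∀ k, t k ∈ Ioo 0 ε) ∧
      ∀ p : ℝ[X], p.natDegree ≤ n → p.eval 1 = ∑ k, c k * p.eval (t k) := by
  -- The nodes are `ε / (k + 2)`; the shift by 2 keeps the node for `k = 0` strictly below `ε`.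
  have hinj : Function.Injective (fun k : Fin (n + 1) => ε / ((k : ℝ) + 2)) := by
    intro k l h
    have hk : (0 : ℝ) < (k : ℝ) + 2 := by positivity
    have hl : (0 : ℝ) < (l : ℝ) + 2 := by positivity
    have h' : ε / ((k : ℝ) + 2) = ε / ((l : ℝ) + 2) := h
    rw [div_eq_div_iff hk.ne' hl.ne'] at h'
    have := mul_left_cancel₀ hε.ne' h'
    apply Fin.ext
    have h2 : (k : ℝ) = l := by linarith
    exact_mod_cast h2
  refine ⟨fun k => ε / ((k : ℝ) + 2), fun k =>
    (Lagrange.basis Finset.univ (fun k : Fin (n + 1) => ε / ((k : ℝ) + 2)) k).eval 1, ?_, ?_⟩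
  · intro k
    have hk : (0 : ℝ) ≤ (k : ℝ) := by positivity
    refine ⟨by positivity, ?_⟩
    rw [div_lt_iff₀ (by positivity)]
    nlinarith
  · intro p hp
    have hdeg : p.degree < (Finset.univ : Finset (Fin (n + 1))).card := by
      simp only [Finset.card_univ, Fintype.card_fin]
      exact lt_of_le_of_lt degree_le_natDegree (by exact_mod_cast Nat.lt_succ_of_le hp)
    conv_lhs => rw [Lagrange.eq_interpolate (hinj.injOn) hdeg, Lagrange.interpolate_apply]
    simp [eval_finsetSum, mul_comm]

open Polynomial in
theorem exists_poly_det_one_add_smul {ι : Type*} [Fintype ι] (A : (ι → ℝ) →L[ℝ] (ι → ℝ)) :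
    ∃ p : ℝ[X], p.natDegree ≤ Fintype.card ι ∧
      ∀ t : ℝ, p.eval t = (ContinuousLinearMap.id ℝ (ι → ℝ) + t • A).det := by
  classical
  refine ⟨_, natDegree_det_X_add_C_le (LinearMap.toMatrix' (A : (ι → ℝ) →ₗ[ℝ] (ι → ℝ))) 1, ?_⟩
  intro t
  rw [ContinuousLinearMap.det, ← LinearMap.det_toMatrix', ← coe_evalRingHom, RingHom.map_det]
  congr 1
  ext i j
  simp [LinearMap.toMatrix'_apply, Matrix.one_apply, Pi.single_apply]
  split_ifs <;> simp [add_comm, mul_comm]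

theorem bijective_add_of_lipschitzWith {E : Type*} [NormedAddCommGroup E] [CompleteSpace E]
    {v : E → E} {c : NNReal} (hc : c < 1) (hv : LipschitzWith c v) :
    Function.Bijective (fun x => x + v x) := by
  constructor
  · intro x y h
    have h1 : dist x y = dist (v x) (v y) := by
      have h' : x + v x = y + v y := h
      rw [dist_comm (v x), dist_eq_norm, dist_eq_norm]
      congr 1
      rw [sub_eq_sub_iff_add_eq_add, h', add_comm]
    have h2 := hv.dist_le_mul x y
    have h3 : (c : ℝ) < 1 := by exact_mod_cast hc
    have h4 : 0 ≤ dist x y := dist_nonneg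
    have : dist x y = 0 := by nlinarith
    exact dist_eq_zero.1 this
  · intro y
    have hcon : ContractingWith c (fun x => y - v x) := by
      refine ⟨hc, LipschitzWith.of_dist_le_mul fun a b => ?_⟩
      simpa only [dist_sub_left] using hv.dist_le_mul a b
    refine ⟨hcon.fixedPoint, ?_⟩
    have := hcon.fixedPoint_isFixedPt
    have h : y - v hcon.fixedPoint = hcon.fixedPoint := this
    change hcon.fixedPoint + v hcon.fixedPoint = y
    nth_rewrite 1 [← h]
    abel

/-- Along `s ↦ I + sA` on `[0, 1]` the determinant starts at 1 and never vanishes, by the Neumann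
series. Positivity removes the absolute value in the change of variables, leaving an integrand
polynomial in `t`. -/
theorem det_one_add_pos_of_norm_lt_one {E : Type*} [NormedAddCommGroup E] [NormedSpace ℝ E]
    [CompleteSpace E] (A : E →L[ℝ] E) (hA : ‖A‖ < 1) :
    0 < (ContinuousLinearMap.id ℝ E + A).det := by
  have hcont : Continuous fun s : ℝ => (ContinuousLinearMap.id ℝ E + s • A).det :=
    ContinuousLinearMap.continuous_det.comp (by fun_prop)
  have hne : ∀ s ∈ Icc (0 : ℝ) 1, (ContinuousLinearMap.id ℝ E + s • A).det ≠ 0 := by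
    intro s hs h0
    have hn : ‖-(s • A)‖ < 1 := by
      rw [norm_neg, norm_smul, Real.norm_of_nonneg hs.1]
      nlinarith [norm_nonneg A, hs.1, hs.2]
    have hu := isUnit_one_sub_of_norm_lt_one hn
    rw [sub_neg_eq_add] at hu
    have hu2 : IsUnit (((1 : E →L[ℝ] E) + s • A : E →L[ℝ] E) : E →ₗ[ℝ] E) :=
      hu.map ContinuousLinearMap.toLinearMapRingHom
    have := (LinearMap.isUnit_det _ hu2).ne_zero
    exact this h0
  by_contra hneg
  push Not at hneg
  have h0 : (ContinuousLinearMap.id ℝ E + (0 : ℝ) • A).det = 1 := by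
    rw [zero_smul, add_zero]; exact LinearMap.det_id
  have := intermediate_value_Icc' (zero_le_one' ℝ) hcont.continuousOn
  obtain ⟨s, hs, hs0⟩ := this (show (0 : ℝ) ∈ _ by rw [h0, one_smul]; exact ⟨hneg, zero_le_one⟩)
  exact hne s hs hs0

open MeasureTheory in
/-- A small Lipschitz perturbation of the identity supported in a ball preserves the volume of
the ball, expressed through the integral of its Jacobian determinant. -/
theorem integral_det_one_add_smul_fderiv {ι : Type*} [Fintype ι] {w : (ι → ℝ) → (ι → ℝ)}
    {L : NNReal} (hw : LipschitzWith L w) {R : ℝ}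
    (h0 : ∀ x, R ≤ ‖x‖ → w x = 0) {t : ℝ} (ht : 0 < t) (htL : t * L < 1) :
    IntegrableOn (fun x => (ContinuousLinearMap.id ℝ (ι → ℝ) + t • fderiv ℝ w x).det)
      (Metric.ball 0 R ∩ {x | DifferentiableAt ℝ w x}) ∧
    ∫ x in Metric.ball 0 R ∩ {x | DifferentiableAt ℝ w x},
      (ContinuousLinearMap.id ℝ (ι → ℝ) + t • fderiv ℝ w x).det =
      volume.real (Metric.ball (0 : ι → ℝ) R) := by
  set B := Metric.ball (0 : ι → ℝ) R
  set s := B ∩ {x | DifferentiableAt ℝ w x}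
  set Φ : (ι → ℝ) → (ι → ℝ) := fun x => x + t • w x with hΦ
  have hs : MeasurableSet s := Metric.isOpen_ball.measurableSet.inter
    (measurableSet_of_differentiableAt ℝ w)
  have hlip : LipschitzWith (t.toNNReal * L) (fun x => t • w x) := by
    refine LipschitzWith.of_dist_le_mul fun x y => ?_
    rw [dist_smul₀, Real.norm_of_nonneg ht.le, NNReal.coe_mul,
      Real.coe_toNNReal t ht.le, mul_assoc]
    exact mul_le_mul_of_nonneg_left (hw.dist_le_mul x y) ht.le
  have hbij : Function.Bijective Φ :=
    bijective_add_of_lipschitzWith (by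
    rw [← NNReal.coe_lt_coe, NNReal.coe_mul, Real.coe_toNNReal t ht.le]
    exact htL) hlip
  have hder : ∀ x ∈ s, HasFDerivWithinAt Φ
      (ContinuousLinearMap.id ℝ (ι → ℝ) + t • fderiv ℝ w x) s x := fun x hx =>
    ((hasFDerivAt_id x).add (hx.2.hasFDerivAt.const_smul t)).hasFDerivWithinAt
  have hpos : ∀ x, 0 < (ContinuousLinearMap.id ℝ (ι → ℝ) + t • fderiv ℝ w x).det := by
    intro x
    refine det_one_add_pos_of_norm_lt_one _ (lt_of_le_of_lt ?_ htL)
    rw [norm_smul, Real.norm_of_nonneg ht.le]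
    exact mul_le_mul_of_nonneg_left (norm_fderiv_le_of_lipschitz ℝ hw) ht.le
  have hout : ∀ x, x ∉ B → Φ x = x := by
    intro x hx
    have : R ≤ ‖x‖ := by simpa [B] using hx
    simp [hΦ, h0 x this]
  -- A bijection that fixes every point outside `B` permutes `B`.
  have himB : Φ '' B = B := by
    apply Subset.antisymm
    · rintro _ ⟨x, hx, rfl⟩
      by_contra hn
      exact hn (by rw [hbij.1 (hout _ hn)]; exact hx)
    · intro y hy
      obtain ⟨x, rfl⟩ := hbij.2 y
      refine ⟨x, ?_, rfl⟩
      by_contra hn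
      exact hn (hout x hn ▸ hy)
  -- Rademacher's theorem, and Lipschitz maps send null sets to null sets.
  have hnull : volume (Φ '' {x | ¬ DifferentiableAt ℝ w x}) = 0 := by
    have h1 : volume {x | ¬ DifferentiableAt ℝ w x} = 0 := hw.ae_differentiableAt
    have hl : LipschitzWith (1 + (t.toNNReal * L)) Φ := LipschitzWith.id.add hlip
    have h2 := hl.hausdorffMeasure_image_le (d := Fintype.card ι) (by positivity)
      {x | ¬ DifferentiableAt ℝ w x}
    rw [hausdorffMeasure_pi_real, h1, mul_zero] at h2
    exact le_antisymm h2 zero_le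
  have hvol : volume (Φ '' s) = volume B := by
    apply le_antisymm
    · exact measure_mono ((image_mono inter_subset_left).trans himB.subset)
    · calc volume B = volume (Φ '' B) := by rw [himB]
        _ ≤ volume (Φ '' s ∪ Φ '' {x | ¬ DifferentiableAt ℝ w x}) := by
            refine measure_mono ?_
            rw [← image_union]
            refine image_mono fun x hx => ?_
            by_cases hd : DifferentiableAt ℝ w x
            · exact Or.inl ⟨hx, hd⟩
            · exact Or.inr hd
        _ ≤ volume (Φ '' s) + 0 := hnull ▸ measure_union_le _ _
        _ = _ := add_zero _
  have hfin : volume (Φ '' s) ≠ ⊤ := hvol ▸ measure_ball_lt_top.ne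
  have hint := (integrableOn_image_iff_integrableOn_abs_det_fderiv_smul volume hs hder
    hbij.1.injOn (fun _ => (1 : ℝ))).1 (integrableOn_const hfin)
  have heq := integral_image_eq_integral_abs_det_fderiv_smul volume hs hder
    hbij.1.injOn (fun _ => (1 : ℝ))
  simp only [abs_of_pos (hpos _), smul_eq_mul, mul_one] at hint heq
  refine ⟨hint, heq.symm.trans ?_⟩
  simp [Measure.real, hvol]

-- Extrapolating from small nodes `t k` to `t = 1` as a finite linear combination of integrals
-- avoids integrating the coefficients of the polynomial separately.
open MeasureTheory in
theorem exists_det_one_add_fderiv_ne_zero {ι : Type*} [Fintype ι] {w : (ι → ℝ) → (ι → ℝ)}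
    {L : NNReal} (hw : LipschitzWith L w) {R : ℝ} (hR : 0 < R)
    (h0 : ∀ x, R ≤ ‖x‖ → w x = 0) :
    ∃ x, ‖x‖ < R ∧ DifferentiableAt ℝ w x ∧
      (ContinuousLinearMap.id ℝ (ι → ℝ) + fderiv ℝ w x).det ≠ 0 := by
  obtain ⟨t, c, ht, hp⟩ := exists_nodes_eval_one (Fintype.card ι)
    (ε := 1 / ((L : ℝ) + 1)) (by positivity)
  have htL : ∀ k, t k * L < 1 := fun k => by
    have h1 := (ht k).2
    rw [lt_div_iff₀ (by positivity)] at h1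
    nlinarith [(ht k).1]
  have key := fun k => integral_det_one_add_smul_fderiv hw h0 (ht k).1 (htL k)
  by_contra! hcon
  have hsum : ∑ k, c k = 1 := by
    simpa using (hp 1 (by simp)).symm
  have hzero : ∀ x ∈ Metric.ball (0 : ι → ℝ) R ∩ {x | DifferentiableAt ℝ w x},
      ∑ k, c k * (ContinuousLinearMap.id ℝ (ι → ℝ) + t k • fderiv ℝ w x).det = 0 := by
    intro x hx
    obtain ⟨p, hdeg, hpe⟩ := exists_poly_det_one_add_smul (fderiv ℝ w x)
    have := hp p hdeg
    simp only [hpe, one_smul] at this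
    rw [← this]
    exact hcon x (by simpa using hx.1) hx.2
  have hs : MeasurableSet (Metric.ball (0 : ι → ℝ) R ∩ {x | DifferentiableAt ℝ w x}) :=
    Metric.isOpen_ball.measurableSet.inter (measurableSet_of_differentiableAt ℝ w)
  have hI := setIntegral_congr_fun (μ := volume) hs hzero
  rw [integral_finsetSum _ (fun k _ => (key k).1.const_mul (c k))] at hI
  simp only [integral_const_mul, (key _).2, integral_zero, ← Finset.sum_mul, hsum, one_mul] at hI
  have : 0 < volume.real (Metric.ball (0 : ι → ℝ) R) :=
    ENNReal.toReal_pos (Metric.measure_ball_pos _ _ hR).ne' measure_ball_lt_top.ne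
  exact this.ne' hI

/-- The bound `‖p‖ ≤ a` absorbs the variation of the denominator, so `p` itself need not be bounded.
-/
theorem lipschitzWith_inv_smul {α E : Type*} [PseudoMetricSpace α] [NormedAddCommGroup E]
    [NormedSpace ℝ E] {p : α → E} {a : α → ℝ} {P A : NNReal} {c : ℝ} (hp : LipschitzWith P p)
    (ha : LipschitzWith A a) (hc : 0 < c) (hca : ∀ x, c ≤ a x) (hpa : ∀ x, ‖p x‖ ≤ a x) :
    LipschitzWith ((P + A) / c).toNNReal (fun x => (a x)⁻¹ • p x) := by
  refine LipschitzWith.of_dist_le' fun x y => ?_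
  have hx := hc.trans_le (hca x)
  have hy := hc.trans_le (hca y)
  have h1 : (a x)⁻¹ • p x - (a y)⁻¹ • p y =
      (a x)⁻¹ • ((p x - p y) + ((a y - a x) / a y) • p y) := by
    rw [smul_add, smul_sub, smul_smul, sub_add]
    congr 1
    rw [← sub_smul]
    congr 1
    field_simp
    ring
  have h2 := hp.dist_le_mul x y
  have h3 := ha.dist_le_mul y x
  rw [dist_comm y x, Real.dist_eq] at h3
  rw [dist_eq_norm (p x)] at h2
  have h4 : ‖((a y - a x) / a y) • p y‖ ≤ A * dist x y := by
    rw [norm_smul, norm_div, Real.norm_eq_abs, Real.norm_of_nonneg hy.le, div_mul_eq_mul_div,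
      div_le_iff₀ hy]
    exact mul_le_mul h3 (hpa y) (norm_nonneg _) (by positivity)
  rw [dist_eq_norm, h1, norm_smul, norm_inv, Real.norm_of_nonneg hx.le]
  calc (a x)⁻¹ * ‖p x - p y + ((a y - a x) / a y) • p y‖
      ≤ c⁻¹ * (P * dist x y + A * dist x y) := by
        gcongr
        · exact hca x
        · exact (norm_add_le _ _).trans (add_le_add h2 h4)
    _ = _ := by ring

/-- No-retraction theorem, for Lipschitz maps and the sup norm. -/
theorem false_of_lipschitz_retraction {ι : Type*} [Fintype ι] {f : (ι → ℝ) → (ι → ℝ)}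
    {L : NNReal} (hf : LipschitzWith L (fun x => f x - x)) {R : ℝ} (hR : 0 < R)
    (hout : ∀ x, R ≤ ‖x‖ → f x = x) (hin : ∀ x, ‖x‖ < R → ‖f x‖ = R) : False := by
  obtain ⟨x, hx, hd, hdet⟩ := exists_det_one_add_fderiv_ne_zero hf hR
    (fun x hx => by simp [hout x hx])
  have hF : HasFDerivAt f (ContinuousLinearMap.id ℝ (ι → ℝ) +
      fderiv ℝ (fun x => f x - x) x) x := by
    have := (hasFDerivAt_id x).add hd.hasFDerivAt
    refine this.congr_of_eventuallyEq (Eventually.of_forall fun y => ?_)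
    simp
  set D := ContinuousLinearMap.id ℝ (ι → ℝ) + fderiv ℝ (fun x => f x - x) x
  obtain ⟨i, hi⟩ : ∃ i, ‖f x i‖ = R := by
    by_contra! hne
    have : ‖f x‖ < R := (pi_norm_lt_iff hR).2 fun i =>
      lt_of_le_of_ne ((norm_le_pi_norm _ i).trans (hin x hx).le) (hne i)
    exact this.ne (hin x hx)
  have hev : ∀ᶠ y in 𝓝 x, |f y i| ≤ R := by
    have : ∀ᶠ y in 𝓝 x, ‖y‖ < R := continuous_norm.continuousAt.eventually_lt_const hx
    filter_upwards [this] with y hy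
    exact (norm_le_pi_norm (f y) i).trans (hin y hy).le
  -- A coordinate of modulus `R` is extremal at `x`, so that row of the derivative vanishes and `D`
  -- cannot be onto.
  have hext : IsLocalExtr (fun y => f y i) x := by
    rw [Real.norm_eq_abs] at hi
    rcases abs_choice (f x i) with h | h
    · right
      filter_upwards [hev] with y hy
      have := (abs_le.1 hy).2
      linarith
    · left
      filter_upwards [hev] with y hy
      have := (abs_le.1 hy).1
      linarith
  have hz : ∀ v, D v i = 0 := by
    have h1 : HasFDerivAt (fun y => f y i) ((ContinuousLinearMap.proj i).comp D) x :=
      (ContinuousLinearMap.proj (R := ℝ) (φ := fun _ : ι => ℝ) i).hasFDerivAt.comp x hF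
    have h2 := hext.fderiv_eq_zero
    rw [h1.fderiv] at h2
    intro v
    exact DFunLike.congr_fun h2 v
  classical
  have hsurj : Function.Surjective D := by
    have := LinearEquiv.surjective
      (LinearEquiv.ofIsUnitDet (f := (D : (ι → ℝ) →ₗ[ℝ] (ι → ℝ)))
        (v := Pi.basisFun ℝ ι) (v' := Pi.basisFun ℝ ι)
        (by rw [LinearMap.det_toMatrix]; exact hdet.isUnit))
    exact this
  obtain ⟨v, hv⟩ := hsurj (Pi.single i 1)
  have := hz v
  rw [hv] at this
  simp at this

/-- **Brouwer's fixed point theorem** for bounded Lipschitz maps of `ℝⁿ`. -/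
theorem exists_fixedPoint_of_lipschitz_bounded {ι : Type*} [Fintype ι] {g : (ι → ℝ) → (ι → ℝ)}
    {L : NNReal} (hg : LipschitzWith L g) {ρ : ℝ} (hρ : ∀ x, ‖g x‖ ≤ ρ) : ∃ x, g x = x := by
  by_contra! hne
  wlog hρ0 : 0 < ρ generalizing ρ
  · exact this (ρ := max ρ 1) (fun x => (hρ x).trans (le_max_left _ _)) (by simp)
  set R := 2 * ρ
  have hR : 0 < R := by positivity
  -- the cutoff `l` equals `1` on the ball of radius `ρ` and vanishes outside the ball of radius `R`
  set l : (ι → ℝ) → ℝ := fun x => max 0 (min 1 (2 - ρ⁻¹ * ‖x‖)) with hl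
  have hl0 : ∀ x, 0 ≤ l x := fun x => le_max_left _ _
  have hl1 : ∀ x, l x ≤ 1 := fun x => max_le zero_le_one (min_le_left _ _)
  have hlR : ∀ x, R ≤ ‖x‖ → l x = 0 := by
    intro x hx
    have : 2 ≤ ρ⁻¹ * ‖x‖ := by
      rw [inv_mul_eq_div, le_div_iff₀ hρ0]; exact hx
    exact max_eq_left ((min_le_right _ _).trans (by linarith))
  have hlρ : ∀ x, ‖x‖ ≤ ρ → l x = 1 := by
    intro x hx
    have : ρ⁻¹ * ‖x‖ ≤ 1 := by
      rw [inv_mul_eq_div, div_le_iff₀ hρ0]; linarith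
    simp only [hl]
    rw [min_eq_left (by linarith)]
    simp
  have hlL : ∀ x y, |l x - l y| ≤ ρ⁻¹ * dist x y := by
    intro x y
    have h1 : |l x - l y| ≤ |(2 - ρ⁻¹ * ‖x‖) - (2 - ρ⁻¹ * ‖y‖)| := by
      refine (abs_max_sub_max_le_max _ _ _ _).trans ?_
      refine max_le (by simp) ((abs_min_sub_min_le_max _ _ _ _).trans ?_)
      exact max_le (by simp) le_rfl
    refine h1.trans ?_
    have h2 : (2 - ρ⁻¹ * ‖x‖) - (2 - ρ⁻¹ * ‖y‖) = ρ⁻¹ * (‖y‖ - ‖x‖) := by ring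
    rw [h2, abs_mul, abs_of_pos (inv_pos.2 hρ0), dist_comm, dist_eq_norm]
    exact mul_le_mul_of_nonneg_left (abs_norm_sub_norm_le _ _) (by positivity)
  -- A zero of `u` has norm at most `ρ`, where the cutoff is 1, so it would be a fixed point of `g`.
  set u : (ι → ℝ) → (ι → ℝ) := fun x => x - l x • g x with hu
  have hlg : LipschitzWith ((L : ℝ) + 1).toNNReal (fun x => l x • g x) := by
    have : ((L : ℝ) + 1) = L + ρ⁻¹ * ρ := by rw [inv_mul_cancel₀ hρ0.ne']
    refine LipschitzWith.of_dist_le' fun x y => ?_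
    have e : l x • g x - l y • g y = l x • (g x - g y) + (l x - l y) • g y := by
      rw [smul_sub, sub_smul]; abel
    rw [dist_eq_norm, e, this, add_mul]
    refine (norm_add_le _ _).trans (add_le_add ?_ ?_)
    · rw [norm_smul, Real.norm_of_nonneg (hl0 x), ← dist_eq_norm]
      have := hg.dist_le_mul x y
      have h5 : 0 ≤ dist (g x) (g y) := dist_nonneg
      nlinarith [hl1 x, hl0 x]
    · rw [norm_smul, mul_right_comm]
      exact mul_le_mul (hlL x y) (hρ y) (norm_nonneg _) (by positivity)
  have huL : LipschitzWith (1 + ((L : ℝ) + 1).toNNReal) u := LipschitzWith.id.sub hlg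
  have hu0 : ∀ x, u x ≠ 0 := by
    intro x hx
    have e : x = l x • g x := sub_eq_zero.1 hx
    have hn : ‖x‖ ≤ ρ := by
      rw [e, norm_smul, Real.norm_of_nonneg (hl0 x)]
      nlinarith [hl1 x, hl0 x, hρ x, norm_nonneg (g x)]
    rw [hlρ x hn, one_smul] at e
    exact hne x e.symm
  have huR : ∀ x, R ≤ ‖x‖ → u x = x := fun x hx => by simp [hu, hlR x hx]
  obtain ⟨m, hm, hmu⟩ : ∃ m, 0 < m ∧ ∀ x ∈ Metric.closedBall (0 : ι → ℝ) R, m ≤ ‖u x‖ := by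
    obtain ⟨x₀, -, hx₀⟩ := (isCompact_closedBall (0 : ι → ℝ) R).exists_isMinOn
      (Metric.nonempty_closedBall.2 hR.le) huL.continuous.norm.continuousOn
    exact ⟨‖u x₀‖, norm_pos_iff.2 (hu0 x₀), hx₀⟩
  -- Scaling by `M` pushes `u` out of the open ball of radius `R`, so projecting it lands on the
  -- sphere.
  set M : ℝ := max 1 (R / m)
  have hM1 : 1 ≤ M := le_max_left _ _
  have hM0 : 0 < M := zero_lt_one.trans_le hM1
  have hMu : ∀ x, R ≤ ‖M • u x‖ := by
    intro x
    rw [norm_smul, Real.norm_of_nonneg hM0.le]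
    rcases le_total ‖x‖ R with h | h
    · have h1 := hmu x (by simpa using h)
      have h2 : R ≤ M * m := (div_le_iff₀ hm).1 (le_max_right _ _)
      nlinarith
    · rw [huR x h]
      nlinarith
  -- the radial projection onto the closed ball of radius `R`
  set P : (ι → ℝ) → (ι → ℝ) := fun x => (max R ‖x‖)⁻¹ • x with hP
  have hPL : LipschitzWith _ P := lipschitzWith_inv_smul (c := R) LipschitzWith.id
    ((lipschitzWith_one_norm (E := ι → ℝ)).const_max R) hR (fun x => le_max_left _ _)
    (fun x => le_max_right _ _)
  have hPn : ∀ x, R ≤ ‖x‖ → ‖R • P x‖ = R := by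
    intro x hx
    have hx0 : 0 < ‖x‖ := hR.trans_le hx
    rw [hP]
    simp only [max_eq_right hx, norm_smul, norm_inv, norm_norm, inv_mul_cancel₀ hx0.ne', mul_one]
    exact Real.norm_of_nonneg hR.le
  have hPin : ∀ x, ‖x‖ ≤ R → R • P x = x := by
    intro x hx
    simp only [hP, max_eq_left hx, smul_smul, mul_inv_cancel₀ hR.ne', one_smul]
  have hPM : ∀ x, R ≤ ‖x‖ → P (M • x) = P x := by
    intro x hx
    have hx0 : 0 < ‖x‖ := hR.trans_le hx
    have h2 : R ≤ ‖M • x‖ := by rw [norm_smul, Real.norm_of_nonneg hM0.le]; nlinarith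
    simp only [hP, max_eq_right hx, max_eq_right h2, smul_smul]
    congr 1
    rw [norm_smul, Real.norm_of_nonneg hM0.le]
    field_simp
  have hfL : LipschitzWith _ (fun x => R • P (M • u x) - R • P x) :=
    ((lipschitzWith_smul R).comp (hPL.comp ((lipschitzWith_smul M).comp huL))).sub
      ((lipschitzWith_smul R).comp hPL)
  -- Inside the ball `R • P x = x`, leaving the projection of `M • u x`; outside, the two
  -- projections cancel.
  refine false_of_lipschitz_retraction (f := fun x => x + (R • P (M • u x) - R • P x))
    (L := _) (R := R) (by simpa only [add_sub_cancel_left] using hfL) hR ?_ ?_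
  · intro x hx
    simp only [huR x hx, hPM x hx, sub_self, add_zero]
  · intro x hx
    simp only [hPin x hx.le, add_sub_cancel]
    exact hPn _ (hMu x)

/-! ### The KKM lemma -/

theorem exists_lipschitzWith_sum {α ι : Type*} [PseudoMetricSpace α] [Fintype ι] {f : ι → α → ℝ}
    (hf : ∀ i, ∃ L : NNReal, LipschitzWith L (f i)) :
    ∃ L : NNReal, LipschitzWith L (fun x => ∑ i, f i x) := by
  choose L hL using hf
  refine ⟨∑ i, L i, LipschitzWith.of_dist_le_mul fun x y => ?_⟩
  rw [NNReal.coe_sum, Finset.sum_mul]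
  exact (dist_sum_sum_le _ _ _).trans (Finset.sum_le_sum fun i _ => (hL i).dist_le_mul x y)

theorem exists_lipschitzWith_pi {α ι : Type*} [PseudoMetricSpace α] [Fintype ι] {f : ι → α → ℝ}
    (hf : ∀ i, ∃ L : NNReal, LipschitzWith L (f i)) :
    ∃ L : NNReal, LipschitzWith L (fun x i => f i x) := by
  choose L hL using hf
  refine ⟨∑ i, L i, LipschitzWith.of_dist_le_mul fun x y => ?_⟩
  refine (dist_pi_le_iff (by positivity)).2 fun i => ((hL i).dist_le_mul x y).trans ?_
  have : L i ≤ ∑ i, L i := Finset.single_le_sum (fun _ _ => zero_le) (Finset.mem_univ i)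
  exact mul_le_mul_of_nonneg_right (by exact_mod_cast this) dist_nonneg

/-- A nonnegative family of Lipschitz functions, with sum bounded below by `c > 0` on a set,
can be normalized there to a globally Lipschitz map. -/
theorem exists_lipschitzWith_normalize {α ι : Type*} [PseudoMetricSpace α] [Fintype ι]
    {f : ι → α → ℝ} (hf : ∀ i, ∃ L : NNReal, LipschitzWith L (f i)) (hf0 : ∀ i x, 0 ≤ f i x)
    {c : ℝ} (hc : 0 < c) :
    ∃ L : NNReal, LipschitzWith L (fun x => (max c (∑ i, f i x))⁻¹ • fun i => f i x) := by
  obtain ⟨L₁, h₁⟩ := exists_lipschitzWith_pi hf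
  obtain ⟨L₂, h₂⟩ := exists_lipschitzWith_sum hf
  refine ⟨_, lipschitzWith_inv_smul h₁ (h₂.const_max c) hc (fun x => le_max_left _ _) fun x => ?_⟩
  refine (pi_norm_le_iff_of_nonneg (hc.le.trans (le_max_left _ _))).2 fun i => ?_
  rw [Real.norm_of_nonneg (hf0 i x)]
  exact (Finset.single_le_sum (fun i _ => hf0 i x) (Finset.mem_univ i)).trans (le_max_right _ _)

theorem inv_smul_mem_stdSimplex {ι : Type*} [Fintype ι] {v : ι → ℝ} (hv : ∀ i, 0 ≤ v i)
    (hs : 0 < ∑ i, v i) : (∑ i, v i)⁻¹ • v ∈ stdSimplex ℝ ι := by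
  refine ⟨fun i => mul_nonneg (inv_nonneg.2 hs.le) (hv i), ?_⟩
  simp only [Pi.smul_apply, smul_eq_mul, ← Finset.mul_sum]
  exact inv_mul_cancel₀ hs.ne'

/-- Take positive parts, spread any deficit of their sum below 1 evenly, then normalize. The sum is
at least 1 before normalizing, and on the simplex nothing changes. -/
theorem exists_lipschitz_retraction_stdSimplex (ι : Type*) [Fintype ι] [Nonempty ι] :
    ∃ (r : (ι → ℝ) → (ι → ℝ)) (L : NNReal), LipschitzWith L r ∧ (∀ x, r x ∈ stdSimplex ℝ ι) ∧
      ∀ x ∈ stdSimplex ℝ ι, r x = x := by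
  set n : ℝ := (Fintype.card ι : ℝ)
  have hn : 0 < n := by simp only [n, Nat.cast_pos, Fintype.card_pos]
  set q : (ι → ℝ) → ℝ := fun x => ∑ i, max (x i) 0
  set s : ι → (ι → ℝ) → ℝ := fun i x => max (x i) 0 + n⁻¹ * max (1 - q x) 0
  have hm : ∀ i, LipschitzWith 1 (fun x : ι → ℝ => max (x i) 0) := fun i =>
    (LipschitzWith.eval i).max_const 0
  obtain ⟨Q, hQ⟩ := exists_lipschitzWith_sum (fun i => ⟨1, hm i⟩)
  have hsL : ∀ i, ∃ L : NNReal, LipschitzWith L (s i) := fun i =>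
    ⟨_, (hm i).add ((lipschitzWith_smul n⁻¹).comp
      (((LipschitzWith.const (1 : ℝ)).sub hQ).max_const 0))⟩
  have hs0 : ∀ i x, 0 ≤ s i x := fun i x =>
    add_nonneg (le_max_right _ _) (mul_nonneg (inv_nonneg.2 hn.le) (le_max_right _ _))
  have hsum : ∀ x, ∑ i, s i x = q x + max (1 - q x) 0 := by
    intro x
    simp only [s, Finset.sum_add_distrib, Finset.sum_const, Finset.card_univ, nsmul_eq_mul]
    rw [← mul_assoc, mul_inv_cancel₀ hn.ne', one_mul]
  have hsum1 : ∀ x, 1 ≤ ∑ i, s i x := fun x => by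
    rw [hsum]
    linarith [le_max_left (1 - q x) 0]
  obtain ⟨L, hL⟩ := exists_lipschitzWith_normalize hsL hs0 one_pos
  refine ⟨_, L, hL, fun x => ?_, fun x hx => ?_⟩
  · rw [max_eq_right (hsum1 x)]
    exact inv_smul_mem_stdSimplex (fun i => hs0 i x) (one_pos.trans_le (hsum1 x))
  · have hx' : ∀ i, max (x i) 0 = x i := fun i => max_eq_left (hx.1 i)
    have hq : q x = 1 := by simp only [q, hx', hx.2]
    rw [hsum]
    ext i
    simp [s, hq, hx']

/-- The **Knaster–Kuratowski–Mazurkiewicz lemma**. -/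
theorem exists_mem_stdSimplex_forall_mem {ι : Type*} [Fintype ι] [Nonempty ι]
    {G : ι → Set (ι → ℝ)} (hG : ∀ i, IsClosed (G i))
    (hcov : ∀ x ∈ stdSimplex ℝ ι, ∃ i, x i ≠ 0 ∧ x ∈ G i) :
    ∃ x ∈ stdSimplex ℝ ι, ∀ i, x ∈ G i := by
  classical
  by_contra! hcon
  have hne : ∀ i, (G i).Nonempty := fun i => by
    obtain ⟨j, hj, hjG⟩ := hcov _ (single_mem_stdSimplex ℝ i)
    have : j = i := by
      by_contra h
      exact hj (by simp [h])
    exact ⟨_, this ▸ hjG⟩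
  set φ : ι → (ι → ℝ) → ℝ := fun i x => Metric.infDist x (G i)
  have hφ0 : ∀ i x, 0 ≤ φ i x := fun i x => Metric.infDist_nonneg
  have hφL : ∀ i, ∃ L : NNReal, LipschitzWith L (φ i) :=
    fun i => ⟨1, Metric.lipschitz_infDist_pt _⟩
  have hφz : ∀ i x, φ i x = 0 ↔ x ∈ G i := fun i x =>
    ((hG i).mem_iff_infDist_zero (hne i)).symm
  obtain ⟨_, hσL⟩ := exists_lipschitzWith_sum hφL
  obtain ⟨c, hc, hcσ⟩ : ∃ c, 0 < c ∧ ∀ x ∈ stdSimplex ℝ ι, c ≤ ∑ i, φ i x := by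
    obtain ⟨x₀, hx₀, hmin⟩ := (isCompact_stdSimplex ℝ ι).exists_isMinOn
      ⟨_, single_mem_stdSimplex ℝ (Classical.arbitrary ι)⟩ hσL.continuous.continuousOn
    obtain ⟨i, hi⟩ := hcon x₀ hx₀
    exact ⟨_, Finset.sum_pos' (fun i _ => hφ0 i x₀) ⟨i, Finset.mem_univ i,
      lt_of_le_of_ne (hφ0 i x₀) fun h => hi ((hφz i x₀).1 h.symm)⟩, hmin⟩
  obtain ⟨r, Lr, hr, hrmem, hrid⟩ := exists_lipschitz_retraction_stdSimplex ι
  obtain ⟨Lh, hh⟩ := exists_lipschitzWith_normalize hφL hφ0 hc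
  -- At a fixed point of `h` in the simplex, `x ∈ G i` forces `x i = 0`, contradicting the covering
  -- hypothesis.
  set h : (ι → ℝ) → (ι → ℝ) := fun x => (max c (∑ i, φ i x))⁻¹ • fun i => φ i x
  have hmem : ∀ x ∈ stdSimplex ℝ ι, h x ∈ stdSimplex ℝ ι := fun x hx => by
    simp only [h, max_eq_right (hcσ x hx)]
    exact inv_smul_mem_stdSimplex (fun i => hφ0 i x) (hc.trans_le (hcσ x hx))
  obtain ⟨x, hx⟩ := exists_fixedPoint_of_lipschitz_bounded (hh.comp hr) (ρ := 1) fun x => by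
    have hx := hmem _ (hrmem x)
    refine (pi_norm_le_iff_of_nonneg zero_le_one).2 fun i => ?_
    rw [Function.comp_apply, Real.norm_of_nonneg (hx.1 i), ← hx.2]
    exact Finset.single_le_sum (fun i _ => hx.1 i) (Finset.mem_univ i)
  have hxs : x ∈ stdSimplex ℝ ι := hx ▸ hmem _ (hrmem x)
  rw [Function.comp_apply, hrid x hxs] at hx
  obtain ⟨i, hi, hiG⟩ := hcov x hxs
  apply hi
  rw [← hx]
  simp [h, (hφz i x).2 hiG]

/-! ### Cones and `C`-convexity -/

section Cone

variable {Z : Type v} [AddCommGroup Z] [Module ℝ Z] [TopologicalSpace Z]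
  [IsTopologicalAddGroup Z] {C : ConvexCone ℝ Z}

theorem ConvexCone.sub_mem_neg_interior {z c : Z} (hz : z ∈ -interior (C : Set Z)) (hc : c ∈ C) :
    z - c ∈ -interior (C : Set Z) := by
  have hsub : interior (C : Set Z) + (C : Set Z) ⊆ interior (C : Set Z) := by
    refine interior_maximal ?_ isOpen_interior.add_right
    rintro _ ⟨a, ha, b, hb, rfl⟩
    exact C.add_mem (interior_subset ha) hb
  rw [Set.mem_neg, neg_sub, sub_eq_add_neg, add_comm]
  exact hsub (add_mem_add hz hc)

end Cone

section Cone

variable {E : Type u} {Z : Type v} [AddCommGroup Z] [Module ℝ Z] [TopologicalSpace Z]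
  [IsTopologicalAddGroup Z] [ContinuousSMul ℝ Z] {C : ConvexCone ℝ Z}

theorem ConvexCone.smul_mem_neg_interior {z : Z} (hz : z ∈ -interior (C : Set Z)) {t : ℝ}
    (ht : 0 < t) : t • z ∈ -interior (C : Set Z) := by
  have hsub : t • interior (C : Set Z) ⊆ interior (C : Set Z) := by
    refine interior_maximal ?_ (isOpen_interior.smul₀ ht.ne')
    rintro _ ⟨a, ha, rfl⟩
    exact C.smul_mem ht (interior_subset ha)
  rw [Set.mem_neg, ← smul_neg]
  exact hsub (smul_mem_smul_set hz)

/-- A `C`-convex map whose values at the endpoints lie in `-int C` and `-C` takes values in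
`-int C` on the segment except possibly at the second endpoint. -/
theorem CConvexOn.mem_neg_interior [AddCommGroup E] [Module ℝ E] {K : Set E} {f : E → Z}
    (hf : CConvexOn C K f) {x y : E} (hx : x ∈ K) (hy : y ∈ K)
    (hfx : f x ∈ -interior (C : Set Z)) (hfy : f y ∈ -(C : Set Z)) {t : ℝ} (ht : 0 < t)
    (ht1 : t < 1) : f (t • x + (1 - t) • y) ∈ -interior (C : Set Z) := by
  have h1 := C.smul_mem (sub_pos.2 ht1) hfy
  have h2 := hf x hx y hy t ⟨ht.le, ht1.le⟩
  have h3 := ConvexCone.sub_mem_neg_interior (ConvexCone.smul_mem_neg_interior hfx ht)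
    (C.add_mem h1 h2)
  convert h3 using 1
  simp only [smul_neg]
  abel

theorem CConvexOn.convex_setOf_mem_neg_interior [AddCommGroup E] [Module ℝ E] {K : Set E}
    {f : E → Z} (hK : Convex ℝ K) (hf : CConvexOn C K f) :
    Convex ℝ {y ∈ K | f y ∈ -interior (C : Set Z)} := by
  refine convex_iff_forall_pos.2 fun x hx y hy a b ha hb hab => ?_
  refine ⟨hK hx.1 hy.1 ha.le hb.le hab, ?_⟩
  obtain rfl : b = 1 - a := by linarith
  exact hf.mem_neg_interior hx.1 hy.1 hx.2 (interior_subset (s := (C : Set Z)) hy.2) ha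
    (by linarith)

end Cone

/-! ### Closedness and weak compactness -/

/-- Indexing by neighborhoods keeps the net in the universe of `E`, as the net conditions require.
-/
theorem exists_net_of_mem_closure {E : Type u} [TopologicalSpace E] {T : Set E} {x : E}
    (hx : x ∈ closure T) :
    ∃ (ι : Type u) (_ : Preorder ι) (_ : IsDirected ι (· ≤ ·)) (_ : Nonempty ι) (a : ι → E),
      (∀ i, a i ∈ T) ∧ Tendsto a atTop (𝓝 x) := by
  have h : ∀ U : {U : Set E // U ∈ 𝓝 x}ᵒᵈ, ∃ y, y ∈ (OrderDual.ofDual U).1 ∩ T := fun U =>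
    mem_closure_iff_nhds.1 hx _ (OrderDual.ofDual U).2
  choose a ha using h
  refine ⟨{U : Set E // U ∈ 𝓝 x}ᵒᵈ, inferInstance, ⟨fun U V => ?_⟩,
    ⟨OrderDual.toDual ⟨univ, univ_mem⟩⟩, a, fun U => (ha U).2, ?_⟩
  · exact ⟨OrderDual.toDual ⟨_, inter_mem (OrderDual.ofDual U).2 (OrderDual.ofDual V).2⟩,
      inter_subset_left, inter_subset_right⟩
  · intro V hV
    have : ∀ U ≥ OrderDual.toDual (⟨V, hV⟩ : {U : Set E // U ∈ 𝓝 x}), a U ∈ V :=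
      fun U hU => hU (ha U).1
    exact mem_map.2 (Filter.mem_of_superset (Ici_mem_atTop _) this)

/-- All three cases rest on `-int C - C ⊆ -int C`, with `-int C` open: a value in `-int C` at the
limit would force one at some point of the set. -/
theorem ClosednessCondition.isClosed {E : Type u} {Z : Type v} [AddCommGroup Z] [Module ℝ Z]
    [TopologicalSpace Z] [IsTopologicalAddGroup Z] {C : ConvexCone ℝ Z} [TopologicalSpace E]
    {K S : Set E} {f : E → Z} (hf : ClosednessCondition C K f) (hS : IsClosed S) (hSK : S ⊆ K) :
    IsClosed {x ∈ S | f x ∉ -interior (C : Set Z)} := by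
  refine isClosed_of_closure_subset fun x hx => ?_
  have hxS : x ∈ S := closure_minimal (sep_subset _ _) hS hx
  refine ⟨hxS, ?_⟩
  rcases hf with hf | hf | hf
  · obtain ⟨ι, _, _, _, a, haT, ha⟩ := exists_net_of_mem_closure hx
    exact hf ι a x (fun i => hSK (haT i).1) (hSK hxS) ha fun i => (haT i).2
  · intro hfx
    obtain ⟨U, hU, hUV⟩ := hf x (hSK hxS) _ (isOpen_interior.neg.mem_nhds hfx)
    obtain ⟨y, hyU, hyS, hy⟩ := mem_closure_iff_nhds.1 hx U hU
    obtain ⟨z, hz, c, hc, hzc⟩ := hUV y ⟨hyU, hSK hyS⟩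
    exact hy (hzc ▸ ConvexCone.sub_mem_neg_interior hz hc)
  · intro hfx
    obtain ⟨ι, _, _, _, a, haT, ha⟩ := exists_net_of_mem_closure hx
    obtain ⟨b, z, hb, hab, hz⟩ := hf ι a x (fun i => hSK (haT i).1) (hSK hxS) ha
    have hzint : z ∈ -interior (C : Set Z) := by
      simpa using ConvexCone.sub_mem_neg_interior hfx hz
    obtain ⟨i, hi⟩ := (hb.eventually (isOpen_interior.neg.mem_nhds hzint)).exists
    refine (haT i).2 ?_
    simpa using ConvexCone.sub_mem_neg_interior hi (hab i)

/-- Convex norm-closed sets are weakly closed; reflexivity makes the bidual embedding onto, so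
bounded sets have weakly compact closure. -/
theorem IsReflexiveSpace.isCompact_weak {X : Type u} [NormedAddCommGroup X] [NormedSpace ℝ X]
    (hX : IsReflexiveSpace X) {s : Set X} (hconv : Convex ℝ s) (hcl : IsClosed s)
    (hb : Bornology.IsBounded s) : IsCompact ((toWeakSpace ℝ X).symm ⁻¹' s) ∧
      IsClosed ((toWeakSpace ℝ X).symm ⁻¹' s) := by
  have himg : (toWeakSpace ℝ X).symm ⁻¹' s = toWeakSpace ℝ X '' s :=
    ((toWeakSpace ℝ X).toEquiv.image_eq_preimage_symm s).symm
  have hclosure : closure ((toWeakSpace ℝ X).symm ⁻¹' s) = (toWeakSpace ℝ X).symm ⁻¹' s := by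
    rw [himg, ← hconv.toWeakSpace_closure ℝ, hcl.closure_eq]
  refine ⟨?_, closure_eq_iff_isClosed.1 hclosure⟩
  rw [← hclosure]
  refine NormedSpace.isCompact_closure_of_isBounded ℝ X _ hb ?_
  have : Function.Surjective (NormedSpace.inclusionInDoubleDualWeak ℝ X) := fun φ => by
    obtain ⟨x, hx⟩ := hX (StrongDual.toWeakDual.symm φ)
    exact ⟨toWeakSpace ℝ X x, by
      rw [← StrongDual.toWeakDual.apply_symm_apply φ, ← hx]; rfl⟩
  rw [this.range_eq]
  exact subset_univ _

/-! ### Existence of equilibria -/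

/-- Existence of a weak vector equilibrium on a bounded set. -/
theorem exists_isWeakVectorEquilibrium_of_isBounded {X : Type u} {Z : Type v}
    [NormedAddCommGroup X] [NormedSpace ℝ X] (hX : IsReflexiveSpace X)
    [AddCommGroup Z] [Module ℝ Z] [TopologicalSpace Z] [IsTopologicalAddGroup Z]
    [ContinuousSMul ℝ Z] {C : ConvexCone ℝ Z} {K B : Set X} (hBK : B ⊆ K) (hK : Convex ℝ K)
    (hBne : B.Nonempty) (hBconv : Convex ℝ B) (hBclosed : IsClosed B)
    (hBb : Bornology.IsBounded B) {F : X → X → X → Z}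
    (h_closed : ∀ y ∈ K, WeakClosednessCondition C K (fun x => F x y x))
    (h_conv : ∀ x ∈ K, CConvexOn C K (fun y => F x y x))
    (h_diag : ∀ x ∈ K, F x x x ∉ -interior (C : Set Z)) :
    ∃ x₀, IsWeakVectorEquilibrium C B F x₀ := by
  classical
  obtain ⟨hcomp, hSclosed⟩ := hX.isCompact_weak hBconv hBclosed hBb
  set S := (toWeakSpace ℝ X).symm ⁻¹' B
  set f : X → WeakSpace ℝ X → Z := fun y x =>
    F ((toWeakSpace ℝ X).symm x) y ((toWeakSpace ℝ X).symm x)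
  set G : B → Set (WeakSpace ℝ X) := fun y => {x ∈ S | f y x ∉ -interior (C : Set Z)}
  have hG : ∀ y, IsClosed (G y) := fun y =>
    (h_closed y (hBK y.2)).isClosed hSclosed (preimage_mono hBK)
  obtain ⟨x, hxS, hx⟩ : (S ∩ ⋂ y, G y).Nonempty := by
    refine hcomp.inter_iInter_nonempty G hG fun s => ?_
    rcases s.eq_empty_or_nonempty with rfl | hs
    · obtain ⟨x, hx⟩ := hBne
      exact ⟨toWeakSpace ℝ X x, by simpa [S] using hx⟩
    have : Nonempty s := hs.coe_sort
    set T : (s → ℝ) → X := fun l => ∑ i, l i • ((i : B) : X)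
    have hT : Continuous T := by fun_prop
    have hTB : ∀ l ∈ stdSimplex ℝ s, T l ∈ B := fun l hl =>
      hBconv.sum_mem (fun i _ => hl.1 i) hl.2 fun i _ => i.1.2
    obtain ⟨l, hl, hlG⟩ := exists_mem_stdSimplex_forall_mem
      (G := fun i : s => (fun l => toWeakSpaceCLM ℝ X (T l)) ⁻¹' G i)
      (fun i => (hG i).preimage ((toWeakSpaceCLM ℝ X).continuous.comp hT)) (by
        intro l hl
        by_contra! hcon
        have hTl := hTB l hl
        have hmem : ∀ i, l i ≠ 0 → ((i : B) : X) ∈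
            {y ∈ K | F (T l) y (T l) ∈ -interior (C : Set Z)} := fun i hi => by
          refine ⟨hBK i.1.2, ?_⟩
          by_contra hn
          exact hcon i hi ⟨hTl, hn⟩
        -- Only vertices with nonzero weight are known to be bad, so the combination is restricted
        -- to them.
        have hsum : ∑ i with l i ≠ 0, l i • ((i : B) : X) = T l :=
          Finset.sum_filter_of_ne fun i _ h h0 => h (by rw [h0, zero_smul])
        have := ((h_conv _ (hBK hTl)).convex_setOf_mem_neg_interior hK).sum_mem
          (t := Finset.univ.filter fun i => l i ≠ 0) (w := l)
          (z := fun i => ((i : B) : X)) (fun i _ => hl.1 i)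
          (by rw [Finset.sum_filter_ne_zero, hl.2])
          (fun i hi => hmem i (Finset.mem_filter.1 hi).2)
        rw [hsum] at this
        exact h_diag _ (hBK hTl) this.2)
    exact ⟨toWeakSpaceCLM ℝ X (T l), hTB l hl, mem_iInter₂.2 fun i hi => hlG ⟨i, hi⟩⟩
  exact ⟨(toWeakSpace ℝ X).symm x, hxS, fun y hy => (mem_iInter.1 hx ⟨y, hy⟩).2⟩

/-- The segment from a point of the open ball towards any other point starts inside the ball. -/
theorem exists_smul_add_mem_closedBall {X : Type u} [NormedAddCommGroup X] [NormedSpace ℝ X]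
    {ρ : ℝ} {x : X} (hx : ‖x‖ < ρ) (y : X) :
    ∃ t ∈ Ioo (0 : ℝ) 1, t • y + (1 - t) • x ∈ Metric.closedBall (0 : X) ρ := by
  have hcont : Continuous fun t : ℝ => ‖t • y + (1 - t) • x‖ := by fun_prop
  have h0 : ∀ᶠ t in 𝓝[>] (0 : ℝ), ‖t • y + (1 - t) • x‖ < ρ :=
    (hcont.continuousAt.eventually_lt_const (by simpa using hx)).filter_mono nhdsWithin_le_nhds
  obtain ⟨t, ht, hmem⟩ := (h0.and (Ioo_mem_nhdsGT zero_lt_one)).exists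
  exact ⟨t, hmem, by simpa using ht.le⟩

theorem theorem4p1 {X : Type u} {Z : Type v}
    [NormedAddCommGroup X] [NormedSpace ℝ X] [CompleteSpace X] (hX : IsReflexiveSpace X)
    [AddCommGroup Z] [Module ℝ Z] [TopologicalSpace Z] [IsTopologicalAddGroup Z]
    [ContinuousSMul ℝ Z] [T2Space Z]
    (C : ConvexCone ℝ Z) (hC : (C : Set Z) ∩ -(C : Set Z) = {0})
    (hCint : (interior (C : Set Z)).Nonempty)
    (K : Set X) (hKne : K.Nonempty) (hKconv : Convex ℝ K) (hKclosed : IsClosed K)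
    (F : X → X → X → Z)
    (h_closed : ∀ y ∈ K, WeakClosednessCondition C K (fun x => F x y x))
    (h_conv : ∀ x ∈ K, CConvexOn C K (fun y => F x y x))
    (h_diag : ∀ x ∈ K, F x x x ∈ -(C : Set Z) \ -interior (C : Set Z))
    (h_coer : ∃ r : ℝ, 0 < r ∧ ∀ x ∈ K, r < ‖x‖ →
      ∃ y₀ ∈ K, ‖y₀‖ < ‖x‖ ∧ F x y₀ x ∈ -(C : Set Z)) :
    ∃ x₀, IsWeakVectorEquilibrium C K F x₀ := by
  obtain ⟨r, -, hr⟩ := h_coer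
  obtain ⟨k, hk⟩ := hKne
  -- `ρ > r` makes coercivity available on the sphere of radius `ρ`; `ρ ≥ ‖k‖` keeps the truncated
  -- set nonempty.
  set ρ := max (r + 1) ‖k‖
  have hrρ : r < ρ := (lt_add_one r).trans_le (le_max_left _ _)
  obtain ⟨x, ⟨hxK, hxρ⟩, hx⟩ := exists_isWeakVectorEquilibrium_of_isBounded hX
    (B := K ∩ Metric.closedBall 0 ρ) inter_subset_left hKconv
    ⟨k, hk, by simp [ρ]⟩ (hKconv.inter (convex_closedBall _ _))
    (hKclosed.inter Metric.isClosed_closedBall)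
    (Metric.isBounded_closedBall.subset inter_subset_right) h_closed h_conv
    (fun x hx => (h_diag x hx).2)
  rw [mem_closedBall_zero_iff] at hxρ
  -- Such a `z` is `x` itself if `‖x‖ < ρ`, by the diagonal condition; otherwise coercivity gives
  -- it. A bad `y ∈ K` can then be moved towards `z` into the ball and stays bad by `C`-convexity.
  obtain ⟨z, hzK, hzρ, hz⟩ : ∃ z ∈ K, ‖z‖ < ρ ∧ F x z x ∈ -(C : Set Z) := by
    rcases hxρ.lt_or_eq with h | h
    · exact ⟨x, hxK, h, (h_diag x hxK).1⟩
    · obtain ⟨z, hzK, hzx, hz⟩ := hr x hxK (h ▸ hrρ)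
      exact ⟨z, hzK, h ▸ hzx, hz⟩
  refine ⟨x, hxK, fun y hy hyneg => ?_⟩
  obtain ⟨t, ht, hmem⟩ := exists_smul_add_mem_closedBall hzρ y
  exact hx _ ⟨hKconv hy hzK ht.1.le (sub_nonneg.2 ht.2.le) (by ring), hmem⟩
    ((h_conv x hxK).mem_neg_interior hy hzK hyneg hz ht.1 ht.2)
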